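/- Let $K$ be a finite geometric simplicial complex in a finite-dimensional real normed space. Simplices are closed, and each simplex $\Delta$ is regarded as a smooth manifold with corners, with tangent space at every point the direction of its affine span. A Lie algebroid on $\Delta$ is a smooth real vector bundle $\mathcal A\to\Delta$ of finite rank with a vector bundle morphism $\gamma:\mathcal A\to T\Delta$ (the anchor) and a real Lie algebra structure on the space $\Gamma(\mathcal A)$ of smooth sections such that $\gamma$ induces a Lie algebra homomorphism $\Gamma(\mathcal A)\to\Gamma(T\Delta)$ and $[\xi,f\eta]=f[\xi,\eta]+(\gamma(\xi)\cdot f)\,\eta$ for $\xi,\eta\in\Gamma(\mathcal A)$, $f\in C^\infty(\Delta)$; it is transitive if $\gamma$ is fibrewise surjective. For a face $\Delta'$ of $\Delta$, the restriction $\mathcal A^{!!}_{\Delta'}$ is the inverse image of the Lie algebroid $\mathcal A$ by the inclusion $\Delta'\hookrightarrow\Delta$; its fibre at $x\in\Delta'$ is $\{a\in\mathcal A_x:\gamma(a)\in T_x\Delta'\}$. A complex of Lie algebroids on $K$ is a family $\underline{\mathcal A}=\{\mathcal A_\Delta\}_{\Delta\in K}$ of transitive Lie algebroids $\mathcal A_\Delta$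 on $\Delta$ with $\mathcal A_{\Delta'}=(\mathcal A_\Delta)^{!!}_{\Delta'}$ whenever $\Delta'$ is a face of $\Delta$ (these identifications being compatible for $\Delta''\subseteq\Delta'\subseteq\Delta$). A piecewise smooth form of degree $p\ge 0$ on $\underline{\mathcal A}$ is a family $\omega=(\omega_\Delta)_{\Delta\in K}$ such that $\omega_\Delta$ is a smooth family of alternating $p$-linear forms $\omega_\Delta(x):(\mathcal A_\Delta)_x^{\,p}\to\mathbb R$, $x\in\Delta$, and $$\omega_{\Delta'}(x)(u_1,\dots,u_p)=\omega_\Delta(x)(u_1,\dots,u_p)$$ for every face $\Delta'$ of $\Delta$, $x\in\Delta'$ and $u_1,\dots,u_p\in(\mathcal A_{\Delta'})_x\subseteq(\mathcal A_\Delta)_x$. Proposition. Let $\underline{\mathcal A}=\{\mathcal A_\Delta\}_{\Delta\in K}$ be a complex of Lie algebroids on $K$, let $L$ be a simplicial subcomplex of $K$, and let $\underline{\mathcal A}^L=\{\mathcal A_\Delta\}_{\Delta\in L}$ be the restricted complex of Lie algebroids. For every $p\ge 0$ and every piecewise smooth form $\xi=(\xi_\Delta)_{\Delta\in L}$ of degree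 $p$ on $\underline{\mathcal A}^L$ there is a piecewise smooth form $\omega=(\omega_\Delta)_{\Delta\in K}$ of degree $p$ on $\underline{\mathcal A}$ with $\omega_\Delta=\xi_\Delta$ for all $\Delta\in L$. -/

import Mathlib

open scoped ContDiff

universe u v

namespace PiecewiseSmooth

/-- The extension by zero to the ambient space of a function given on a subset `S` only. -/
noncomputable def extZero {E : Type v} {V : Type*} [Zero V] {S : Set E} (f : S → V) : E → V :=
  Function.extend Subtype.val f 0

theorem extZero_coe {E : Type v} {V : Type*} [Zero V] {S : Set E} (f : S → V) (x : S) :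
    extZero f (x : E) = f x :=
  Subtype.val_injective.extend_apply f 0 x

section Smooth

variable {E : Type v} [NormedAddCommGroup E] [NormedSpace ℝ E]
variable {V : Type*} [NormedAddCommGroup V] [NormedSpace ℝ V]

/-- `f : S → V` is smooth on the (relatively open) subset `U` of `S`.

Below `S` is always a simplex, that is, a convex set with nonempty interior in its affine span, and
then this is the usual smoothness on a manifold with corners: all derivatives of `f` along `S` exist
up to the boundary and are continuous there. The values of `extZero f` outside `U` play no role. -/
def SmoothOn {S : Set E} (f : S → V) (U : Set S) : Prop :=
  ContDiffOn ℝ ∞ (extZero f) (Subtype.val '' U)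

/-- The derivative at `x ∈ S` of a function `f : S → V`, in the direction of the vector `w`.

It is only used for smooth `f`, convex `S` and `w` in the direction of the affine span of `S`. Such
a `w` is in the linear span of the tangent cone of `S` at `x`, so that the value is the derivative of
`f` along `S`, whichever derivative `fderivWithin` chooses transversally to `S`. -/
noncomputable def dirDeriv {S : Set E} (f : S → V) (x : S) (w : E) : V :=
  fderivWithin ℝ (extZero f) S x w

theorem SmoothOn.add {S : Set E} {f g : S → V} {U : Set S} (hf : SmoothOn f U)
    (hg : SmoothOn g U) : SmoothOn (fun x => f x + g x) U := by
  refine ContDiffOn.congr (ContDiffOn.add hf hg) ?_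
  rintro _ ⟨x, -, rfl⟩
  simp only [extZero_coe]

theorem SmoothOn.smul {S : Set E} {f : S → ℝ} {g : S → V} {U : Set S} (hf : SmoothOn f U)
    (hg : SmoothOn g U) : SmoothOn (fun x => f x • g x) U := by
  refine ContDiffOn.congr (ContDiffOn.smul hf hg) ?_
  rintro _ ⟨x, -, rfl⟩
  simp only [Pi.smul_apply', extZero_coe]

theorem smoothOn_const {S : Set E} (c : V) (U : Set S) : SmoothOn (fun _ : S => c) U := by
  refine ContDiffOn.congr (f := fun _ => c) contDiffOn_const ?_
  rintro _ ⟨x, -, rfl⟩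
  simp only [extZero_coe]

theorem SmoothOn.mono {S : Set E} {f : S → V} {U W : Set S} (hf : SmoothOn f U)
    (h : W ⊆ U) : SmoothOn f W :=
  ContDiffOn.mono hf (Set.image_mono h)

end Smooth

section Bundles

variable {E : Type v} [NormedAddCommGroup E] [NormedSpace ℝ E]

/-- A local trivialization of rank `r`, over an open subset of `S`, of a family of real vector
spaces indexed by `S`: the fibrewise linear isomorphisms `coord x`, with inverse `frame x`. The
values of `coord` and `frame` outside the base set play no role. -/
structure LocalTriv {S : Set E} (F : S → Type u) [∀ x, AddCommGroup (F x)] [∀ x, Module ℝ (F x)]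
    (r : ℕ) where
  baseSet : Set S
  isOpen_baseSet : IsOpen baseSet
  coord : ∀ x : S, F x →ₗ[ℝ] (Fin r → ℝ)
  frame : ∀ x : S, (Fin r → ℝ) →ₗ[ℝ] F x
  frame_coord : ∀ x ∈ baseSet, ∀ a : F x, frame x (coord x a) = a
  coord_frame : ∀ x ∈ baseSet, ∀ c : Fin r → ℝ, coord x (frame x c) = c

/-- A smooth real vector bundle of finite rank on `S`: a family of vector spaces, with an atlas of
local trivializations that cover `S` and whose transition functions are smooth. -/
structure SmoothVectorBundle (S : Set E) where
  Fiber : S → Type u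
  [addCommGroup : ∀ x, AddCommGroup (Fiber x)]
  [module : ∀ x, Module ℝ (Fiber x)]
  rank : ℕ
  atlas : Set (LocalTriv Fiber rank)
  cover : ∀ x : S, ∃ e ∈ atlas, x ∈ e.baseSet
  smooth_transition : ∀ e ∈ atlas, ∀ e' ∈ atlas, ∀ c : Fin rank → ℝ,
    SmoothOn (fun x => e'.coord x (e.frame x c)) (e.baseSet ∩ e'.baseSet)

attribute [instance] SmoothVectorBundle.addCommGroup SmoothVectorBundle.module

namespace SmoothVectorBundle

variable {S : Set E}

/-- The real vector space `Γ(B)` of the (global) smooth sections of the bundle `B`. -/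
def sections (B : SmoothVectorBundle.{u} S) : Submodule ℝ (∀ x, B.Fiber x) where
  carrier := {σ | ∀ e ∈ B.atlas, SmoothOn (fun x => e.coord x (σ x)) e.baseSet}
  add_mem' := by
    intro σ τ hσ hτ e he
    simpa only [Pi.add_apply, map_add] using (hσ e he).add (hτ e he)
  zero_mem' := by
    intro e _
    simpa only [Pi.zero_apply, map_zero] using smoothOn_const (0 : Fin B.rank → ℝ) e.baseSet
  smul_mem' := by
    intro c σ hσ e he
    simpa only [Pi.smul_apply, map_smul] using (smoothOn_const c e.baseSet).smul (hσ e he)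

/-- The product `f σ` of a smooth function and a smooth section. -/
def funSMul (B : SmoothVectorBundle.{u} S) (f : S → ℝ) (hf : SmoothOn f Set.univ)
    (σ : B.sections) : B.sections :=
  ⟨fun x => f x • σ.1 x, by
    intro e he
    simpa only [map_smul] using (hf.mono (Set.subset_univ e.baseSet)).smul (σ.2 e he)⟩

/-- A smooth form of degree `p` on a vector bundle `B`, with real values: a smooth family of
alternating `p`-linear forms on the fibres of `B`. -/
@[ext]
structure SmoothForm (B : SmoothVectorBundle.{u} S) (p : ℕ) where
  toFun : ∀ x : S, B.Fiber x [⋀^Fin p]→ₗ[ℝ] ℝ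
  smooth : ∀ e ∈ B.atlas, ∀ c : Fin p → Fin B.rank → ℝ,
    SmoothOn (fun x => toFun x (fun i => e.frame x (c i))) e.baseSet

end SmoothVectorBundle

/-- A Lie algebroid on a simplex `S`. The tangent space of `S` at any of its points (on the boundary
as well) is the direction `vectorSpan ℝ S` of the affine span of `S`; a vector field on `S` is a
function from `S` to this space. -/
structure LieAlgebroid (S : Set E) extends SmoothVectorBundle.{u} S where
  anchor : ∀ x : S, Fiber x →ₗ[ℝ] vectorSpan ℝ S
  anchor_smooth : ∀ e ∈ atlas, ∀ c : Fin rank → ℝ,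
    SmoothOn (fun x => anchor x (e.frame x c)) e.baseSet
  bracket : toSmoothVectorBundle.sections →ₗ[ℝ]
    toSmoothVectorBundle.sections →ₗ[ℝ] toSmoothVectorBundle.sections
  bracket_self : ∀ ξ, bracket ξ ξ = 0
  jacobi : ∀ ξ η ζ, bracket ξ (bracket η ζ) = bracket (bracket ξ η) ζ + bracket η (bracket ξ ζ)
  /-- The anchor sends the bracket of sections to the bracket of vector fields on `S`. -/
  anchor_bracket : ∀ ξ η (x : S), (anchor x ((bracket ξ η).1 x) : E) =
    VectorField.lieBracketWithin ℝ (extZero fun y => (anchor y (ξ.1 y) : E))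
      (extZero fun y => (anchor y (η.1 y) : E)) S x
  /-- `[ξ, f η] = f [ξ, η] + (γ(ξ) ⬝ f) η` for every smooth function `f` on `S`. -/
  leibniz : ∀ ξ η (f : S → ℝ) (hf : SmoothOn f Set.univ) (x : S),
    (bracket ξ (toSmoothVectorBundle.funSMul f hf η)).1 x =
      f x • (bracket ξ η).1 x + dirDeriv f x (anchor x (ξ.1 x)) • η.1 x

namespace LieAlgebroid

variable {S T : Set E}

/-- A Lie algebroid is transitive if its anchor is (fibrewise) surjective. -/
def IsTransitive (A : LieAlgebroid.{u} S) : Prop :=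
  ∀ x, Function.Surjective (A.anchor x)

/-- An identification of the Lie algebroid `A'` on `T ⊆ S` with the restriction of the Lie
algebroid `A` on `S` to `T`, that is, with the inverse image of `A` by the inclusion `T → S`.

The fibre of the inverse image at `x ∈ T` is the fibre product `{(X, a) ∈ TₓT × Aₓ | γ(a) = X}`, its
anchor is the first projection, and the identification is `a' ↦ (γ'(a'), incl x a')`: so
`incl x : A'ₓ → Aₓ` is injective, with image `{a ∈ Aₓ | γ(a) ∈ TₓT}`. -/
structure RestrictionIso (A : LieAlgebroid.{u} S) (A' : LieAlgebroid.{u} T) (h : T ⊆ S) where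
  incl : ∀ x : T, A'.Fiber x →ₗ[ℝ] A.Fiber (Set.inclusion h x)
  smooth : ∀ e' ∈ A'.atlas, ∀ e ∈ A.atlas, ∀ c : Fin A'.rank → ℝ,
    SmoothOn (fun x : T => e.coord (Set.inclusion h x) (incl x (e'.frame x c)))
      (e'.baseSet ∩ Set.inclusion h ⁻¹' e.baseSet)
  anchor_incl : ∀ (x : T) (a : A'.Fiber x),
    (A.anchor (Set.inclusion h x) (incl x a) : E) = A'.anchor x a
  injective : ∀ x, Function.Injective (incl x)
  surjective : ∀ (x : T) (a : A.Fiber (Set.inclusion h x)),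
    (A.anchor (Set.inclusion h x) a : E) ∈ vectorSpan ℝ T → ∃ a' : A'.Fiber x, incl x a' = a
  /-- The bracket is that of the inverse image: for sections `ξ = ∑ fᵢ aᵢ` and `η = ∑ gⱼ bⱼ`, with
  smooth functions `fᵢ`, `gⱼ` on `T` and (restrictions to `T` of) sections `aᵢ`, `bⱼ` of `A`, one has
  `[ξ, η] = ∑ fᵢ gⱼ [aᵢ, bⱼ] + ∑ (γ'(ξ) ⬝ gⱼ) bⱼ - ∑ (γ'(η) ⬝ fᵢ) aᵢ`. -/
  bracket_eq : ∀ (n m : ℕ) (ξ η : A'.sections) (f : Fin n → T → ℝ) (g : Fin m → T → ℝ)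
    (a : Fin n → A.sections) (b : Fin m → A.sections),
    (∀ i, SmoothOn (f i) Set.univ) → (∀ j, SmoothOn (g j) Set.univ) →
    (∀ x, incl x (ξ.1 x) = ∑ i, f i x • (a i).1 (Set.inclusion h x)) →
    (∀ x, incl x (η.1 x) = ∑ j, g j x • (b j).1 (Set.inclusion h x)) →
    ∀ x, incl x ((A'.bracket ξ η).1 x) =
      ∑ i, ∑ j, (f i x * g j x) • (A.bracket (a i) (b j)).1 (Set.inclusion h x)
      + ∑ j, dirDeriv (g j) x (A'.anchor x (ξ.1 x)) • (b j).1 (Set.inclusion h x)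
      - ∑ i, dirDeriv (f i) x (A'.anchor x (η.1 x)) • (a i).1 (Set.inclusion h x)

end LieAlgebroid

/-- The closed simplex with vertex set `s`. -/
abbrev simplex (s : Finset E) : Set E := convexHull ℝ (s : Set E)

theorem simplex_mono {s t : Finset E} (h : t ⊆ s) : simplex t ⊆ simplex s :=
  convexHull_mono (Finset.coe_subset.2 h)

/-- A complex of Lie algebroids on a simplicial complex `K`: a transitive Lie algebroid `obj s` on
each simplex `s` of `K`, such that `obj t` is the restriction of `obj s` for each face `t` of `s`.
The equalities `obj t = (obj s)` restricted to `t` are given as identifications, which are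
transitive: for `r ⊆ t ⊆ s`, the fibres of `obj r` sit in the fibres of `obj s` in the same way
directly and through `obj t`. -/
structure LieAlgebroidComplex (K : Geometry.SimplicialComplex ℝ E) where
  obj : ∀ s ∈ K.faces, LieAlgebroid.{u} (simplex s)
  transitive : ∀ s (hs : s ∈ K.faces), (obj s hs).IsTransitive
  res : ∀ s (hs : s ∈ K.faces) t (ht : t ∈ K.faces) (h : t ⊆ s),
    LieAlgebroid.RestrictionIso (obj s hs) (obj t ht) (simplex_mono h)
  res_self : ∀ s (hs : s ∈ K.faces) (x : simplex s) (a : (obj s hs).Fiber x),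
    (res s hs s hs (Finset.Subset.refl s)).incl x a = a
  res_trans : ∀ s (hs : s ∈ K.faces) t (ht : t ∈ K.faces) r (hr : r ∈ K.faces)
    (hts : t ⊆ s) (hrt : r ⊆ t) (x : simplex r) (a : (obj r hr).Fiber x),
    (res s hs t ht hts).incl (Set.inclusion (simplex_mono hrt) x) ((res t ht r hr hrt).incl x a) =
      (res s hs r hr (hrt.trans hts)).incl x a

/-- The restriction of a complex of Lie algebroids to a simplicial subcomplex. -/
def LieAlgebroidComplex.restrict {K L : Geometry.SimplicialComplex ℝ E}
    (A : LieAlgebroidComplex.{u} K) (hL : L.faces ⊆ K.faces) : LieAlgebroidComplex.{u} L where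
  obj s hs := A.obj s (hL hs)
  transitive s hs := A.transitive s (hL hs)
  res s hs t ht h := A.res s (hL hs) t (hL ht) h
  res_self s hs := A.res_self s (hL hs)
  res_trans s hs t ht r hr := A.res_trans s (hL hs) t (hL ht) r (hL hr)

/-- A piecewise smooth form of degree `p` on a complex of Lie algebroids: a smooth form on each
Lie algebroid, such that the form on a face `t` of a simplex `s` is the restriction of the form
on `s`. -/
@[ext]
structure PiecewiseSmoothForm {K : Geometry.SimplicialComplex ℝ E} (A : LieAlgebroidComplex.{u} K)
    (p : ℕ) where
  form : ∀ s (hs : s ∈ K.faces), (A.obj s hs).SmoothForm p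
  compat : ∀ s (hs : s ∈ K.faces) t (ht : t ∈ K.faces) (h : t ⊆ s) (x : simplex t)
    (w : Fin p → (A.obj t ht).Fiber x),
    (form s hs).toFun (Set.inclusion (simplex_mono h) x)
      (fun i => (A.res s hs t ht h).incl x (w i)) = (form t ht).toFun x w

/-- The restriction of a piecewise smooth form to a simplicial subcomplex. -/
def PiecewiseSmoothForm.restrict {K L : Geometry.SimplicialComplex ℝ E}
    {A : LieAlgebroidComplex.{u} K} {p : ℕ} (θ : PiecewiseSmoothForm A p)
    (hL : L.faces ⊆ K.faces) : PiecewiseSmoothForm (A.restrict hL) p where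
  form s hs := θ.form s (hL hs)
  compat s hs t ht := θ.compat s (hL hs) t (hL ht)

end Bundles

end PiecewiseSmooth

namespace PiecewiseSmooth

open Filter Topology

/-! The form is extended one skeleton at a time. A simplex outside `L` receives a form once all its
proper faces carry compatible ones, and finiteness of `K` bounds the number of stages. Everything
thus reduces to a single simplex `s` whose proper faces carry compatible forms
(`exists_extension_of_faces`). Prescribing the values on the faces is an affine, hence convex,
condition on the form at each point, so a partition of unity reduces the problem to a neighbourhood
of a point `x₀` (`exists_smoothForm_of_local`).

Near `x₀`, transitivity gives a trivialization in which the anchor is a constant surjection `G`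
(`IsTransitive.exists_localTriv`). The fibres over a face `F` then become the fixed subspace of all
`c` with `G c` tangent to `F`. The form on each facet through `x₀` extends to the full fibres `ℝ^r`
over that facet (`RestrictionIso.exists_local_extension`). Two such extensions need agree only on
vectors with anchor tangent to both facets.

They are glued facet by facet (`exists_extension_of_facets`). If `Ψ` is right on the facets treated
so far, it is replaced by `Ψ + π*(Φ - Ψ)`, where `π` is an affine retraction onto the next facet,
lifted to the fibres compatibly with `G`. Since `π` preserves the other facets through `x₀`, the
correction vanishes on tangent vectors over the facets already treated. -/

theorem eventually_nhdsWithin_iff_subtype {X : Type*} [TopologicalSpace X] {S : Set X} {x : S}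
    {P : X → Prop} :
    (∀ᶠ y in 𝓝[S] (x : X), P y) ↔ ∀ᶠ y : S in 𝓝 x, P (y : X) := by
  rw [nhdsWithin_eq_map_subtype_coe x.2, eventually_map]

theorem nhdsWithin_coe_image {X : Type*} [TopologicalSpace X] {S : Set X} {U : Set S}
    (hU : IsOpen U) {x : S} (hx : x ∈ U) :
    𝓝[Subtype.val '' U] (x : X) = 𝓝[S] (x : X) := by
  obtain ⟨O, hO, rfl⟩ := hU
  rw [Subtype.image_preimage_coe, 
    nhdsWithin_inter_of_mem' (mem_nhdsWithin_of_mem_nhds (hO.mem_nhds hx))]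

/-! ### Pointwise smoothness for functions on a subset. -/

section Calculus

variable {E : Type v} [NormedAddCommGroup E] [NormedSpace ℝ E]
variable {V W : Type*} [NormedAddCommGroup V] [NormedSpace ℝ V]
  [NormedAddCommGroup W] [NormedSpace ℝ W]
variable {S : Set E}

/-- Smoothness at a point of `S`. -/
def SmoothAt (f : S → V) (x : S) : Prop :=
  ContDiffWithinAt ℝ ∞ (extZero f) S x

theorem SmoothAt.congr {f g : S → V} {x : S} (hf : SmoothAt f x) (h : g =ᶠ[𝓝 x] f) :
    SmoothAt g x := by
  refine ContDiffWithinAt.congr_of_eventuallyEq hf ?_ ?_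
  · refine eventually_nhdsWithin_iff_subtype.2 (h.mono fun y hy => ?_)
    simpa only [extZero_coe] using hy
  · simpa only [extZero_coe] using h.self_of_nhds

theorem smoothOn_iff {U : Set S} (hU : IsOpen U) {f : S → V} :
    SmoothOn f U ↔ ∀ x ∈ U, SmoothAt f x := by
  constructor
  · intro h x hx
    exact (contDiffWithinAt_congr_set (nhdsWithin_eq_iff_eventuallyEq.1
      (nhdsWithin_coe_image hU hx))).1 (h x ⟨x, hx, rfl⟩)
  · rintro h _ ⟨x, hx, rfl⟩
    exact (contDiffWithinAt_congr_set (nhdsWithin_eq_iff_eventuallyEq.1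
      (nhdsWithin_coe_image hU hx))).2 (h x hx)

theorem SmoothAt.comp {h : V → W} {f : S → V} {x : S} (hh : ContDiffAt ℝ ∞ h (f x))
    (hf : SmoothAt f x) : SmoothAt (fun y => h (f y)) x := by
  have : ContDiffWithinAt ℝ ∞ (h ∘ extZero f) S x :=
    ContDiffAt.comp_contDiffWithinAt (x : E) (by rwa [extZero_coe]) hf
  refine this.congr_of_eventuallyEq ?_ ?_
  · refine eventually_nhdsWithin_iff_subtype.2 (Eventually.of_forall fun y => ?_)
    simp only [extZero_coe, Function.comp]
  · simp only [extZero_coe, Function.comp]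

theorem SmoothAt.of_contDiffWithinAt {h : E → V} {x : S} (hh : ContDiffWithinAt ℝ ∞ h S x) :
    SmoothAt (fun y : S => h y) x := by
  refine hh.congr_of_eventuallyEq ?_ ?_
  · refine eventually_nhdsWithin_iff_subtype.2 (Eventually.of_forall fun y => ?_)
    simp only [extZero_coe]
  · simp only [extZero_coe]

/-- Serves two kinds of `m`: the inclusion of a face, with `φ = id`, and a retraction onto a facet,
with `φ` affine. -/
theorem SmoothAt.comp_map {T : Set E} {f : T → V} {φ : E → E} (hφ : ContDiff ℝ ∞ φ)
    {m : S → T} (hm : ∀ y, (m y : E) = φ y) {x : S} (hf : SmoothAt f (m x)) :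
    SmoothAt (fun y => f (m y)) x := by
  have : ContDiffWithinAt ℝ ∞ (extZero f ∘ φ) S x := by
    refine ContDiffWithinAt.comp (t := T) (x : E) ?_ hφ.contDiffAt.contDiffWithinAt ?_
    · rw [← hm]; exact hf
    · intro y hy
      rw [← hm ⟨y, hy⟩]
      exact (m ⟨y, hy⟩).2
  refine (SmoothAt.of_contDiffWithinAt this).congr (Eventually.of_forall fun y => ?_)
  simp only [Function.comp, ← hm, extZero_coe]

theorem smoothAt_const (c : V) (x : S) : SmoothAt (fun _ => c) x :=
  SmoothAt.of_contDiffWithinAt (h := fun _ => c) contDiffWithinAt_const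

theorem SmoothAt.add {f g : S → V} {x : S} (hf : SmoothAt f x) (hg : SmoothAt g x) :
    SmoothAt (fun y => f y + g y) x := by
  refine (SmoothAt.of_contDiffWithinAt (ContDiffWithinAt.add hf hg)).congr
    (Eventually.of_forall fun y => ?_)
  simp only [extZero_coe]

theorem SmoothAt.sub {f g : S → V} {x : S} (hf : SmoothAt f x) (hg : SmoothAt g x) :
    SmoothAt (fun y => f y - g y) x := by
  refine (SmoothAt.of_contDiffWithinAt (ContDiffWithinAt.sub hf hg)).congr
    (Eventually.of_forall fun y => ?_)
  simp only [extZero_coe]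

theorem SmoothAt.smul {f : S → ℝ} {g : S → V} {x : S} (hf : SmoothAt f x) (hg : SmoothAt g x) :
    SmoothAt (fun y => f y • g y) x := by
  refine (SmoothAt.of_contDiffWithinAt (ContDiffWithinAt.smul hf hg)).congr
    (Eventually.of_forall fun y => ?_)
  simp only [Pi.smul_apply', extZero_coe]

theorem SmoothAt.sum {ι : Type*} {s : Finset ι} {f : ι → S → V} {x : S}
    (hf : ∀ i ∈ s, SmoothAt (f i) x) : SmoothAt (fun y => ∑ i ∈ s, f i y) x := by
  classical
  induction s using Finset.induction_on with
  | empty => simpa using smoothAt_const (0 : V) x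
  | insert i s hi ih =>
    simp only [Finset.sum_insert hi]
    exact (hf i (Finset.mem_insert_self i s)).add
      (ih fun j hj => hf j (Finset.mem_insert_of_mem hj))

theorem SmoothAt.prod {ι : Type*} {s : Finset ι} {f : ι → S → ℝ} {x : S}
    (hf : ∀ i ∈ s, SmoothAt (f i) x) : SmoothAt (fun y => ∏ i ∈ s, f i y) x := by
  classical
  induction s using Finset.induction_on with
  | empty => simpa using smoothAt_const (1 : ℝ) x
  | insert i s hi ih =>
    simp only [Finset.prod_insert hi]
    exact (hf i (Finset.mem_insert_self i s)).smul
      (ih fun j hj => hf j (Finset.mem_insert_of_mem hj))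

theorem SmoothAt.clm {f : S → V} {x : S} (hf : SmoothAt f x) (l : V →L[ℝ] W) :
    SmoothAt (fun y => l (f y)) x :=
  SmoothAt.comp l.contDiff.contDiffAt hf

theorem SmoothAt.linearMap [FiniteDimensional ℝ V] {f : S → V} {x : S} (hf : SmoothAt f x)
    (l : V →ₗ[ℝ] W) : SmoothAt (fun y => l (f y)) x :=
  hf.clm (LinearMap.toContinuousLinearMap l)

theorem SmoothAt.continuousAt {f : S → V} {x : S} (hf : SmoothAt f x) : ContinuousAt f x := by
  have h := ContDiffWithinAt.continuousWithinAt hf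
  rw [ContinuousWithinAt, nhdsWithin_eq_map_subtype_coe x.2, tendsto_map'_iff, extZero_coe] at h
  refine h.congr fun y => ?_
  simp only [Function.comp, extZero_coe]

end Calculus

/-! ### Smooth families of linear and alternating maps. -/

section Families

variable {E : Type v} [NormedAddCommGroup E] [NormedSpace ℝ E]
variable {V : Type*} [NormedAddCommGroup V] [NormedSpace ℝ V]
variable {S : Set E} {r p : ℕ}

theorem SmoothAt.linear_apply {M : S → (Fin r → ℝ) →ₗ[ℝ] V} {x : S}
    (hM : ∀ c, SmoothAt (fun y => M y c) x) {w : S → Fin r → ℝ} (hw : SmoothAt w x) :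
    SmoothAt (fun y => M y (w y)) x := by
  have : (fun y => M y (w y)) = fun y => ∑ j, w y j • M y (Pi.single j 1) := by
    funext y
    conv_lhs => rw [pi_eq_sum_univ' (w y), map_sum]
    simp only [map_smul]
  rw [this]
  exact SmoothAt.sum fun j _ =>
    (hw.clm (ContinuousLinearMap.proj (R := ℝ) (φ := fun _ : Fin r => ℝ) j)).smul (hM _)

/-- Multilinear expansion in the standard basis leaves finitely many products of coordinates of the
`w k` with values of `Φ` on constant vectors. -/
theorem SmoothAt.alternating_apply {Φ : S → (Fin r → ℝ) [⋀^Fin p]→ₗ[ℝ] ℝ} {x : S}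
    (hΦ : ∀ c, SmoothAt (fun y => Φ y c) x) {w : Fin p → S → Fin r → ℝ}
    (hw : ∀ k, SmoothAt (w k) x) :
    SmoothAt (fun y => Φ y fun k => w k y) x := by
  have : (fun y => Φ y fun k => w k y) = fun y => ∑ j : Fin p → Fin r,
      (∏ k, w k y (j k)) • Φ y fun k => Pi.single (j k) 1 := by
    funext y
    have h : (fun k => w k y) = fun k => ∑ j, w k y j • (Pi.single j 1 : Fin r → ℝ) := by
      funext k
      conv_lhs => rw [pi_eq_sum_univ' (w k y)]
    rw [h]
    erw [MultilinearMap.map_sum]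
    exact Finset.sum_congr rfl fun j _ => MultilinearMap.map_smul_univ _ _ _
  rw [this]
  exact SmoothAt.sum fun j _ => (SmoothAt.prod fun k _ =>
    (hw k).clm (ContinuousLinearMap.proj (R := ℝ) (φ := fun _ : Fin r => ℝ) (j k))).smul (hΦ _)

/-- Passes from smoothness on each constant vector to smoothness in operator norm, where inversion
is a smooth map near units. -/
theorem smoothAt_toContinuousLinearMap {M : S → (Fin r → ℝ) →ₗ[ℝ] V} {x : S}
    (hM : ∀ c, SmoothAt (fun y => M y c) x) :
    SmoothAt (fun y => LinearMap.toContinuousLinearMap (M y)) x := by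
  have : (fun y => LinearMap.toContinuousLinearMap (M y)) = fun y => ∑ j,
      ContinuousLinearMap.smulRightL ℝ (Fin r → ℝ) V
        (ContinuousLinearMap.proj (R := ℝ) (φ := fun _ : Fin r => ℝ) j) (M y (Pi.single j 1)) := by
    funext y
    ext c
    simp only [LinearMap.coe_toContinuousLinearMap', sum_apply]
    conv_lhs => rw [pi_eq_sum_univ' c, map_sum]
    simp
  rw [this]
  exact SmoothAt.sum fun j _ => (hM _).clm _

/-- A smooth family of endomorphisms that is the identity at a point has a smooth family of inverses
near the point. -/
theorem exists_smooth_inverse {M : S → (Fin r → ℝ) →ₗ[ℝ] (Fin r → ℝ)} {x : S}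
    (hM : ∀ᶠ y in 𝓝 x, ∀ c, SmoothAt (fun z => M z c) y) (h1 : M x = LinearMap.id) :
    ∃ N : S → (Fin r → ℝ) →ₗ[ℝ] (Fin r → ℝ),
      (∀ᶠ y in 𝓝 x, ∀ c, SmoothAt (fun z => N z c) y) ∧
      ∀ᶠ y in 𝓝 x, (∀ c, N y (M y c) = c) ∧ ∀ c, M y (N y c) = c := by
  set F : S → (Fin r → ℝ) →L[ℝ] (Fin r → ℝ) := fun y => LinearMap.toContinuousLinearMap (M y)
    with hF
  have hu : ∀ᶠ y in 𝓝 x, IsUnit (F y) := by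
    have hc : ContinuousAt F x := (smoothAt_toContinuousLinearMap hM.self_of_nhds).continuousAt
    refine hc.eventually (Units.isOpen.mem_nhds ?_)
    have : F x = 1 := by
      ext c : 1
      simp [hF, h1]
    change IsUnit (F x)
    rw [this]
    exact isUnit_one
  refine ⟨fun y => (Ring.inverse (F y) : (Fin r → ℝ) →L[ℝ] (Fin r → ℝ)).toLinearMap, ?_, ?_⟩
  · filter_upwards [hM, hu] with y hy huy c
    obtain ⟨U, hU⟩ := huy
    have h2 : SmoothAt (fun z => Ring.inverse (F z)) y :=
      SmoothAt.comp (h := Ring.inverse) (hU ▸ contDiffAt_ringInverse ℝ U)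
        (smoothAt_toContinuousLinearMap hy)
    exact h2.clm (ContinuousLinearMap.apply ℝ (Fin r → ℝ) c)
  · filter_upwards [hu] with y huy
    constructor
    · intro c
      have := congrArg (fun g : (Fin r → ℝ) →L[ℝ] (Fin r → ℝ) => g c)
        (Ring.inverse_mul_cancel _ huy)
      simpa [hF] using this
    · intro c
      have := congrArg (fun g : (Fin r → ℝ) →L[ℝ] (Fin r → ℝ) => g c)
        (Ring.mul_inverse_cancel _ huy)
      simpa [hF] using this

end Families

theorem sum_smul_apply {ι F : Type*} [AddCommGroup F] [Module ℝ F] {p : ℕ} (s : Finset ι)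
    (a : ι → ℝ) (θ : ι → F [⋀^Fin p]→ₗ[ℝ] ℝ) (w : Fin p → F) :
    (∑ k ∈ s, a k • θ k) w = ∑ k ∈ s, a k • θ k w := by
  classical
  induction s using Finset.induction_on with
  | empty => simp
  | insert i s hi ih => simp only [Finset.sum_insert hi, AlternatingMap.add_apply, ih,
      AlternatingMap.smul_apply]

/-! ### Gluing of local forms, adapted trivializations, extension off a face. -/

section LocalForms

variable {E : Type v} [NormedAddCommGroup E] [NormedSpace ℝ E] {S : Set E}

namespace SmoothVectorBundle

/-- A local trivialization that is smoothly compatible with the atlas of a vector bundle. -/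
structure IsCompatible (B : SmoothVectorBundle.{u} S) (e : LocalTriv B.Fiber B.rank) : Prop where
  smoothAt_coord_atlas : ∀ e' ∈ B.atlas, ∀ x ∈ e.baseSet, x ∈ e'.baseSet → ∀ c,
    SmoothAt (fun y => e'.coord y (e.frame y c)) x
  smoothAt_coord : ∀ e' ∈ B.atlas, ∀ x ∈ e.baseSet, x ∈ e'.baseSet → ∀ c,
    SmoothAt (fun y => e.coord y (e'.frame y c)) x

theorem isCompatible_of_mem_atlas (B : SmoothVectorBundle.{u} S) {e : LocalTriv B.Fiber B.rank}
    (he : e ∈ B.atlas) : B.IsCompatible e where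
  smoothAt_coord_atlas e' he' x hx hx' c :=
    (smoothOn_iff (e.isOpen_baseSet.inter e'.isOpen_baseSet)).1
      (B.smooth_transition e he e' he' c) x ⟨hx, hx'⟩
  smoothAt_coord e' he' x hx hx' c :=
    (smoothOn_iff (e'.isOpen_baseSet.inter e.isOpen_baseSet)).1
      (B.smooth_transition e' he' e he c) x ⟨hx', hx⟩

/-- Smoothness at a point of a family of alternating forms on the fibres of a vector bundle. -/
def SmoothFormAt (B : SmoothVectorBundle.{u} S) {p : ℕ} (θ : ∀ x : S, B.Fiber x [⋀^Fin p]→ₗ[ℝ] ℝ)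
    (x : S) : Prop :=
  ∀ e ∈ B.atlas, x ∈ e.baseSet → ∀ c : Fin p → Fin B.rank → ℝ,
    SmoothAt (fun y => θ y (fun i => e.frame y (c i))) x

/-- Needed for trivializations outside the atlas, such as those made to have constant anchor. -/
theorem IsCompatible.smoothFormAt {B : SmoothVectorBundle.{u} S} {e : LocalTriv B.Fiber B.rank}
    (he : B.IsCompatible e) {p : ℕ} {Φ : S → (Fin B.rank → ℝ) [⋀^Fin p]→ₗ[ℝ] ℝ} {x : S}
    (hx : x ∈ e.baseSet) (hΦ : ∀ c, SmoothAt (fun y => Φ y c) x) :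
    B.SmoothFormAt (fun y => (Φ y).compLinearMap (e.coord y)) x := by
  intro e' he' hx' c
  exact SmoothAt.alternating_apply hΦ fun k => he.smoothAt_coord e' he' x hx hx' (c k)

/-- Local solutions of a fibrewise convex condition on forms can be glued to a global one. -/
theorem exists_smoothForm_of_local [FiniteDimensional ℝ E] (hS : IsCompact S)
    (B : SmoothVectorBundle.{u} S) {p : ℕ} (C : ∀ x : S, Set (B.Fiber x [⋀^Fin p]→ₗ[ℝ] ℝ))
    (hC : ∀ x, Convex ℝ (C x))
    (hloc : ∀ x₀ : S, ∃ θ : ∀ x : S, B.Fiber x [⋀^Fin p]→ₗ[ℝ] ℝ,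
      ∀ᶠ x in 𝓝 x₀, B.SmoothFormAt θ x ∧ θ x ∈ C x) :
    ∃ θ : B.SmoothForm p, ∀ x, θ.toFun x ∈ C x := by
  choose θ hθ using hloc
  have hO : ∀ x₀ : S, ∃ O : Set E, IsOpen O ∧ (x₀ : E) ∈ O ∧
      ∀ x : S, (x : E) ∈ O → B.SmoothFormAt (θ x₀) x ∧ θ x₀ x ∈ C x := by
    intro x₀
    obtain ⟨U, hU, hUo, hx₀⟩ := mem_nhds_iff.1 (hθ x₀)
    obtain ⟨O, hO, rfl⟩ := hUo
    exact ⟨O, hO, hx₀, fun x hx => hU hx⟩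
  choose O hOo hOx hOθ using hO
  obtain ⟨F, hF⟩ := hS.elim_finite_subcover O hOo fun x hx =>
    Set.mem_iUnion.2 ⟨⟨x, hx⟩, hOx ⟨x, hx⟩⟩
  obtain ⟨f, hf⟩ := SmoothPartitionOfUnity.exists_isSubordinate (modelWithCornersSelf ℝ E)
    hS.isClosed (fun k : F => O k) (fun k => hOo k) (by
      intro x hx
      obtain ⟨k, hk, hxk⟩ := Set.mem_iUnion₂.1 (hF hx)
      exact Set.mem_iUnion.2 ⟨⟨k, hk⟩, hxk⟩)
  refine ⟨⟨fun x => ∑ k : F, f k (x : E) • θ k x, ?_⟩, ?_⟩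
  · intro e he c
    refine (smoothOn_iff e.isOpen_baseSet).2 fun x hx => ?_
    have : (fun y : S => (∑ k : F, f k (y : E) • θ k y) fun i => e.frame y (c i)) =
        fun y : S => ∑ k : F, f k (y : E) • θ k y fun i => e.frame y (c i) := by
      funext y
      exact sum_smul_apply _ _ _ _
    rw [this]
    refine SmoothAt.sum fun k _ => ?_
    -- `θ k` is known to be smooth only on `O k`; off the support of `f k` the product vanishes near
    -- `x`.
    by_cases hk : (x : E) ∈ tsupport (f k)
    · have hfk : ContDiff ℝ ∞ (f k) := (f k).contMDiff.contDiff
      exact (SmoothAt.of_contDiffWithinAt hfk.contDiffAt.contDiffWithinAt).smul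
        ((hOθ k x (hf k hk)).1 e he hx c)
    · refine (smoothAt_const (0 : ℝ) x).congr ?_
      have : ∀ᶠ y : E in 𝓝 (x : E), f k y = 0 := notMem_tsupport_iff_eventuallyEq.1 hk
      filter_upwards [continuous_subtype_val.continuousAt.eventually this] with y hy
      rw [hy, zero_smul]
  · intro x
    change ∑ k : F, f k (x : E) • θ k x ∈ C x
    rw [← finsum_eq_sum_of_fintype]
    exact (hC x).finsum_mem (fun k => f.nonneg k x) (f.sum_eq_one x.2)
      fun k hk => (hOθ k x (hf k (subset_tsupport _ hk))).2

end SmoothVectorBundle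

namespace LieAlgebroid

/-- Near each point, a transitive Lie algebroid has a trivialization in which the anchor is
constant. -/
theorem IsTransitive.exists_localTriv [FiniteDimensional ℝ E] {A : LieAlgebroid.{u} S}
    (hA : A.IsTransitive) (x₀ : S) :
    ∃ e : LocalTriv A.Fiber A.rank, A.IsCompatible e ∧ x₀ ∈ e.baseSet ∧
      ∃ G : (Fin A.rank → ℝ) →ₗ[ℝ] vectorSpan ℝ S, Function.Surjective G ∧
        ∀ x ∈ e.baseSet, ∀ a, G (e.coord x a) = A.anchor x a := by
  obtain ⟨e, he, hx₀⟩ := A.cover x₀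
  have hec := A.isCompatible_of_mem_atlas he
  set G : (Fin A.rank → ℝ) →ₗ[ℝ] vectorSpan ℝ S := A.anchor x₀ ∘ₗ e.frame x₀ with hG
  have hGs : Function.Surjective G := by
    intro w
    obtain ⟨a, rfl⟩ := hA x₀ w
    exact ⟨e.coord x₀ a, by simp [hG, e.frame_coord x₀ hx₀]⟩
  obtain ⟨σ, hσ⟩ := LinearMap.exists_rightInverse_of_surjective G (LinearMap.range_eq_top.2 hGs)
  have hσ' : ∀ w, G (σ w) = w := fun w => congrArg (fun l => l w) hσ
  -- Change of frame straightening the anchor: `G ∘ M x` is the anchor at `x` in the coordinates of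
  -- `e`, and `M x₀ = id`, so `M x` is invertible near `x₀` and `M x ∘ e.coord x` is a
  -- trivialization with anchor `G`.
  set M : S → (Fin A.rank → ℝ) →ₗ[ℝ] (Fin A.rank → ℝ) := fun x =>
    LinearMap.id + σ ∘ₗ (A.anchor x ∘ₗ e.frame x - G) with hM
  have hMs : ∀ x ∈ e.baseSet, ∀ c, SmoothAt (fun z => M z c) x := fun x hx c =>
    (smoothAt_const c x).add ((((smoothOn_iff e.isOpen_baseSet).1 (A.anchor_smooth e he c) x hx).sub
      (smoothAt_const (G c) x)).linearMap σ)
  have hGM : ∀ x c, G (M x c) = A.anchor x (e.frame x c) := by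
    intro x c
    simp [hM, hσ']
  obtain ⟨N, hN, hNM⟩ := exists_smooth_inverse (M := M) (x := x₀)
    ((e.isOpen_baseSet.eventually_mem hx₀).mono hMs)
    (by simp [hM, hG])
  obtain ⟨U, hU, hUo, hxU⟩ := mem_nhds_iff.1
    (inter_mem (e.isOpen_baseSet.mem_nhds hx₀) (inter_mem hN hNM))
  refine ⟨⟨U, hUo, fun x => M x ∘ₗ e.coord x, fun x => e.frame x ∘ₗ N x, ?_, ?_⟩, ⟨?_, ?_⟩, hxU, G,
    hGs, ?_⟩
  · intro x hx a
    simp [(hU hx).2.2.1, e.frame_coord x (hU hx).1]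
  · intro x hx c
    simp [(hU hx).2.2.2, e.coord_frame x (hU hx).1]
  · intro e' he' x hx hx' c
    exact SmoothAt.linear_apply (M := fun y => e'.coord y ∘ₗ e.frame y)
      (hec.smoothAt_coord_atlas e' he' x (hU hx).1 hx') ((hU hx).2.1 c)
  · intro e' he' x hx hx' c
    exact SmoothAt.linear_apply (hMs x (hU hx).1) (hec.smoothAt_coord e' he' x (hU hx).1 hx' c)
  · intro x hx a
    simp [hGM, e.frame_coord x (hU hx).1]

/-- A form on the restriction of a Lie algebroid to a subset extends, near each point of the subset,
to a smooth family of forms on the fibres of the Lie algebroid. -/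
theorem RestrictionIso.exists_local_extension {T : Set E} {A : LieAlgebroid.{u} S}
    {A' : LieAlgebroid.{u} T} {h : T ⊆ S} (R : RestrictionIso A A' h) {p : ℕ}
    (θ : A'.SmoothForm p) {e : LocalTriv A.Fiber A.rank} (he : A.IsCompatible e) (x₀ : T)
    (hx₀ : Set.inclusion h x₀ ∈ e.baseSet) :
    ∃ Φ : T → (Fin A.rank → ℝ) [⋀^Fin p]→ₗ[ℝ] ℝ,
      (∀ᶠ x in 𝓝 x₀, ∀ c, SmoothAt (fun y => Φ y c) x) ∧
      ∀ᶠ x in 𝓝 x₀, ∀ w : Fin p → A'.Fiber x,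
        Φ x (fun k => e.coord (Set.inclusion h x) (R.incl x (w k))) = θ.toFun x w := by
  obtain ⟨e', he', hx'⟩ := A'.cover x₀
  have hbase : ∀ᶠ x in 𝓝 x₀, x ∈ e'.baseSet ∧ Set.inclusion h x ∈ e.baseSet :=
    (e'.isOpen_baseSet.eventually_mem hx').and
      ((continuous_inclusion h).continuousAt.eventually (e.isOpen_baseSet.mem_nhds hx₀))
  set N : T → (Fin A'.rank → ℝ) →ₗ[ℝ] (Fin A.rank → ℝ) := fun x =>
    e.coord (Set.inclusion h x) ∘ₗ R.incl x ∘ₗ e'.frame x with hN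
  have hNs : ∀ x, x ∈ e'.baseSet → Set.inclusion h x ∈ e.baseSet → ∀ c,
      SmoothAt (fun y => N y c) x := by
    intro x hx hxe c
    obtain ⟨e₁, he₁, hx₁⟩ := A.cover (Set.inclusion h x)
    have h₁ : SmoothAt (fun y : T => e₁.coord (Set.inclusion h y) (R.incl y (e'.frame y c))) x :=
      (smoothOn_iff (e'.isOpen_baseSet.inter
        (e₁.isOpen_baseSet.preimage (continuous_inclusion h)))).1
        (R.smooth e' he' e₁ he₁ c) x ⟨hx, hx₁⟩
    have h₂ : ∀ d, SmoothAt (fun y : T =>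
        e.coord (Set.inclusion h y) (e₁.frame (Set.inclusion h y) d)) x := fun d =>
      SmoothAt.comp_map (f := fun y => e.coord y (e₁.frame y d)) (m := Set.inclusion h)
        (φ := id) contDiff_id
        (fun _ => rfl) (he.smoothAt_coord e₁ he₁ _ hxe hx₁ d)
    refine (SmoothAt.linear_apply (M := fun y : T =>
      e.coord (Set.inclusion h y) ∘ₗ e₁.frame (Set.inclusion h y)) h₂ h₁).congr ?_
    filter_upwards [(continuous_inclusion h).continuousAt.eventually
      (e₁.isOpen_baseSet.mem_nhds hx₁)] with y hy
    simp [hN, e₁.frame_coord _ hy]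
  have hinj : Function.Injective (N x₀) := by
    intro c d hcd
    have h₁ := congrArg (e.frame (Set.inclusion h x₀)) hcd
    simp only [hN, LinearMap.comp_apply, e.frame_coord _ hx₀] at h₁
    have h₂ := congrArg (e'.coord x₀) (R.injective _ h₁)
    rwa [e'.coord_frame _ hx', e'.coord_frame _ hx'] at h₂
  -- `l` inverts the inclusion of fibres on the left only at `x₀`; with `Q x` the inverse of `l ∘ N
  -- x`, the map `Q x ∘ l` is a left inverse of `N x` near `x₀`. Precomposing the form with this
  -- smooth family of projections extends it.
  obtain ⟨l, hl⟩ := LinearMap.exists_leftInverse_of_injective (N x₀) (LinearMap.ker_eq_bot.2 hinj)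
  obtain ⟨Q, hQ, hQN⟩ := exists_smooth_inverse (M := fun x => l ∘ₗ N x) (x := x₀)
    (hbase.mono fun x hx c => (hNs x hx.1 hx.2 c).linearMap l) hl
  refine ⟨fun x => (θ.toFun x).compLinearMap (e'.frame x ∘ₗ Q x ∘ₗ l), ?_, ?_⟩
  · filter_upwards [hbase, hQ] with x hx hQx c
    exact SmoothAt.alternating_apply
      (Φ := fun y => (θ.toFun y).compLinearMap (e'.frame y))
      (fun c => (smoothOn_iff e'.isOpen_baseSet).1 (θ.smooth e' he' c) x hx.1)
      fun k => hQx (l (c k))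
  · filter_upwards [hbase, hQN] with x hx hQx w
    simp only [AlternatingMap.compLinearMap_apply, LinearMap.comp_apply]
    congr 1
    funext k
    have := hQx.1 (e'.coord x (w k))
    simp only [hN, LinearMap.comp_apply, e'.frame_coord _ hx.1] at this
    rw [this, e'.frame_coord _ hx.1]

end LieAlgebroid

end LocalForms

/-! ### Affine maps, direction spaces and convex hulls. -/

section Affine

variable {E : Type*} [AddCommGroup E] [Module ℝ E]

theorem linear_mem_vectorSpan {π : E →ᵃ[ℝ] E} {A B : Set E} (h : Set.MapsTo π A B) {w : E}
    (hw : w ∈ vectorSpan ℝ A) : π.linear w ∈ vectorSpan ℝ B :=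
  vectorSpan_mono ℝ h.image_subset (π.map_vectorSpan (s := A) ▸ Submodule.mem_map_of_mem hw)

theorem linear_eq_self_of_mem_vectorSpan {π : E →ᵃ[ℝ] E} {A : Set E} (h : ∀ x ∈ A, π x = x) {w : E}
    (hw : w ∈ vectorSpan ℝ A) : π.linear w = w := by
  induction hw using Submodule.span_induction with
  | mem w hw =>
    obtain ⟨x, hx, y, hy, rfl⟩ := hw
    simp only [AffineMap.linearMap_vsub, h x hx, h y hy]
  | zero => exact map_zero _
  | add a b _ _ ha hb => rw [map_add, ha, hb]
  | smul t a _ ha => rw [map_smul, ha]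

theorem eq_self_of_mem_convexHull {π : E →ᵃ[ℝ] E} {A : Set E} (h : ∀ x ∈ A, π x = x) {x : E}
    (hx : x ∈ convexHull ℝ A) : π x = x := by
  refine convexHull_min (t := {y | π y = y}) h ?_ hx
  intro y hy z hz a b _ _ hab
  change π y = y at hy
  change π z = z at hz
  change π (a • y + b • z) = a • y + b • z
  rw [Convex.combo_affine_apply hab, hy, hz]

theorem mapsTo_convexHull {π : E →ᵃ[ℝ] E} {A B : Set E} (h : Set.MapsTo π A B) :
    Set.MapsTo π (convexHull ℝ A) (convexHull ℝ B) := by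
  rw [Set.mapsTo_iff_image_subset, π.image_convexHull]
  exact convexHull_mono h.image_subset

/-- An affine map on an affinely independent set is given by arbitrary values. -/
theorem exists_affineMap_eqOn {s : Set E} (hs : AffineIndependent ℝ ((↑) : s → E)) {j : E}
    (hj : j ∈ s) (f : E → E) : ∃ π : E →ᵃ[ℝ] E, ∀ x ∈ s, π x = f x := by
  have hli := (affineIndependent_iff_linearIndependent_vsub ℝ _ (⟨j, hj⟩ : s)).1 hs
  obtain ⟨l, hl⟩ := LinearMap.exists_extend ((Module.Basis.span hli).constr ℝ
    fun x : {x : s // x ≠ ⟨j, hj⟩} => f x.1 - f j)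
  have hl' : ∀ x : {x : s // x ≠ ⟨j, hj⟩}, l (x.1 - j) = f x.1 - f j := by
    intro x
    have := Module.Basis.constr_basis (Module.Basis.span hli) ℝ
      (fun x : {x : s // x ≠ ⟨j, hj⟩} => f x.1 - f j) x
    rw [← hl, LinearMap.comp_apply, Submodule.subtype_apply, Module.Basis.span_apply] at this
    exact this
  refine ⟨AffineMap.mk' (fun x => l (x - j) + f j) l j fun x => by simp, fun x hx => ?_⟩
  by_cases hxj : x = j
  · simp [hxj]
  · have := hl' ⟨⟨x, hx⟩, fun h => hxj (congrArg Subtype.val h)⟩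
    simp [-map_sub, this]

end Affine

/-! ### Retractions onto facets and gluing of facet data. -/

section Facets

variable {E : Type v} [NormedAddCommGroup E] [NormedSpace ℝ E]

/-- In a simplex, a point lies outside the facet opposite to some vertex. -/
theorem exists_vertex_notMem_facet [DecidableEq E] {s : Finset E}
    (hs : AffineIndependent ℝ ((↑) : s → E)) {x : E} (hx : x ∈ simplex s) :
    ∃ j ∈ s, x ∉ simplex (s.erase j) := by
  by_contra! h
  -- By affine independence, the facets opposite the vertices of `t` meet in the face spanned by `s
  -- \ t`; for `t = s` this is empty.
  have key : ∀ t : Finset E, t ⊆ s → x ∈ simplex (s \ t) := by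
    intro t
    induction t using Finset.induction_on with
    | empty => simpa using hx
    | insert a t _ ih =>
      intro hts
      have h₁ := ih ((Finset.subset_insert a t).trans hts)
      have h₂ := h a (hts (Finset.mem_insert_self a t))
      have h₃ := hs.convexHull_inter (Finset.sdiff_subset (s := s) (t := t)) (s.erase_subset a)
      have h₄ : (↑(s \ t) ∩ ↑(s.erase a) : Set E) = ↑(s \ insert a t) := by
        ext y
        simp
        tauto
      rw [h₄] at h₃
      rw [simplex, h₃]
      exact ⟨h₁, h₂⟩
  simpa [simplex] using key s subset_rfl

/-- For each facet through `x`, an affine retraction of the simplex onto the facet that preserves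
all the other facets through `x`. -/
theorem exists_facet_retraction [DecidableEq E] {s : Finset E}
    (hs : AffineIndependent ℝ ((↑) : s → E)) {x : E} (hx : x ∈ simplex s) :
    ∃ π : E → E →ᵃ[ℝ] E, ∀ i ∈ s, x ∈ simplex (s.erase i) →
      Set.MapsTo (π i) (simplex s) (simplex (s.erase i)) ∧
      (∀ y ∈ simplex (s.erase i), π i y = y) ∧
      ∀ k, x ∈ simplex (s.erase k) →
        Set.MapsTo (π i) (simplex (s.erase k)) (simplex (s.erase k)) := by
  obtain ⟨j, hj, hxj⟩ := exists_vertex_notMem_facet hs hx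
  -- `π i` moves the vertex `i` to `j` and fixes the others. The facet opposite `j` misses `x`, so
  -- every facet through `x` contains `j` and is preserved.
  choose π hπ using fun i : E =>
    exists_affineMap_eqOn (s := (s : Set E)) hs hj fun y => if y = i then j else y
  refine ⟨π, fun i hi hxi => ⟨mapsTo_convexHull ?_, fun y hy => eq_self_of_mem_convexHull ?_ hy,
    fun k hxk => mapsTo_convexHull ?_⟩⟩
  · intro y hy
    rw [hπ i y hy]
    have : j ≠ i := by rintro rfl; exact hxj hxi
    split_ifs with h
    · exact Finset.mem_coe.2 (Finset.mem_erase.2 ⟨this, hj⟩)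
    · exact Finset.mem_coe.2 (Finset.mem_erase.2 ⟨h, hy⟩)
  · intro y hy
    obtain ⟨h₁, h₂⟩ := Finset.mem_erase.1 (Finset.mem_coe.1 hy)
    rw [hπ i y h₂, if_neg h₁]
  · intro y hy
    rw [hπ i y (Finset.mem_of_mem_erase (Finset.mem_coe.1 hy))]
    have : j ≠ k := by rintro rfl; exact hxj hxk
    split_ifs with h
    · exact Finset.mem_coe.2 (Finset.mem_erase.2 ⟨this, hj⟩)
    · exact hy

/-- Compatible smooth families of alternating forms on the facets through a point extend to the
neighbourhood of the point. -/
theorem exists_extension_of_facets [FiniteDimensional ℝ E] {ι : Type*} {S : Set E} {F : ι → Set E}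
    (hFS : ∀ i, F i ⊆ S)
    (x₀ : S) (hx₀ : ∀ i, (x₀ : E) ∈ F i) (π : ι → E →ᵃ[ℝ] E) (hπS : ∀ i, Set.MapsTo (π i) S (F i))
    (hπ : ∀ i, ∀ x ∈ F i, π i x = x) (hπF : ∀ i j, Set.MapsTo (π i) (F j) (F j))
    {r p : ℕ} {G : (Fin r → ℝ) →ₗ[ℝ] vectorSpan ℝ S} (hG : Function.Surjective G)
    {Φ : ∀ i, F i → (Fin r → ℝ) [⋀^Fin p]→ₗ[ℝ] ℝ}
    (hΦ : ∀ i, ∀ᶠ x in 𝓝 (⟨x₀, hx₀ i⟩ : F i), ∀ c, SmoothAt (fun y => Φ i y c) x)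
    (hcompat : ∀ i j, ∀ᶠ x : S in 𝓝 x₀, ∀ (hi : (x : E) ∈ F i) (hj : (x : E) ∈ F j)
      (c : Fin p → Fin r → ℝ), (∀ k, (G (c k) : E) ∈ vectorSpan ℝ (F i ∩ F j)) →
        Φ i ⟨x, hi⟩ c = Φ j ⟨x, hj⟩ c)
    (I : Finset ι) :
    ∃ Ψ : S → (Fin r → ℝ) [⋀^Fin p]→ₗ[ℝ] ℝ,
      (∀ᶠ x in 𝓝 x₀, ∀ c, SmoothAt (fun y => Ψ y c) x) ∧
      ∀ i ∈ I, ∀ᶠ x : S in 𝓝 x₀, ∀ (hi : (x : E) ∈ F i) (c : Fin p → Fin r → ℝ),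
        (∀ k, (G (c k) : E) ∈ vectorSpan ℝ (F i)) → Ψ x c = Φ i ⟨x, hi⟩ c := by
  classical
  obtain ⟨σ, hσ⟩ := LinearMap.exists_rightInverse_of_surjective G (LinearMap.range_eq_top.2 hG)
  have hσ' : ∀ w, G (σ w) = w := fun w => congrArg (fun l => l w) hσ
  induction I using Finset.induction_on with
  | empty => exact ⟨fun _ => 0, Eventually.of_forall fun x c => smoothAt_const 0 x, by simp⟩
  | insert i I _ ih =>
    obtain ⟨Ψ, hΨ, hΨI⟩ := ih
    have hlin : ∀ w ∈ vectorSpan ℝ S, (π i).linear w ∈ vectorSpan ℝ S := fun w hw =>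
      vectorSpan_mono ℝ (hFS i) (linear_mem_vectorSpan (hπS i) hw)
    -- A lift of the derivative of `π i` through `G`, equal to the identity on vectors whose anchor
    -- is tangent to `F i`.
    set q : (Fin r → ℝ) →ₗ[ℝ] (Fin r → ℝ) :=
      LinearMap.id - σ ∘ₗ (G - (π i).linear.restrict hlin ∘ₗ G) with hq
    have hGq : ∀ c, (G (q c) : E) = (π i).linear (G c) := by
      intro c
      simp [hq, hσ']
    have hqc : ∀ c, (G c : E) ∈ vectorSpan ℝ (F i) → q c = c := by
      intro c hc
      have : (π i).linear.restrict hlin (G c) = G c :=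
        Subtype.ext (linear_eq_self_of_mem_vectorSpan (hπ i) hc)
      simp [hq, this]
    set m : S → F i := fun x => ⟨π i x, hπS i x.2⟩ with hm
    set n : S → S := fun x => ⟨π i x, hFS i (hπS i x.2)⟩ with hn
    have hπc : Continuous (π i) := (π i).continuous_of_finiteDimensional
    have hπd : ContDiff ℝ ∞ (π i) := by
      have h₁ : (π i : E → E) = fun y => (π i).linear y + π i 0 := (π i).decomp
      rw [h₁]
      exact (LinearMap.toContinuousLinearMap (π i).linear).contDiff.add contDiff_const
    have hm₀ : m x₀ = ⟨x₀, hx₀ i⟩ := Subtype.ext (hπ i _ (hx₀ i))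
    have hn₀ : n x₀ = x₀ := Subtype.ext (hπ i _ (hx₀ i))
    have hmt : Tendsto m (𝓝 x₀) (𝓝 ⟨x₀, hx₀ i⟩) := hm₀ ▸
      ((hπc.comp continuous_subtype_val).subtype_mk _).continuousAt
    have hnt : Tendsto n (𝓝 x₀) (𝓝 x₀) := by
      have : ContinuousAt n x₀ := ((hπc.comp continuous_subtype_val).subtype_mk _).continuousAt
      rwa [ContinuousAt, hn₀] at this
    refine ⟨fun x => Ψ x + (Φ i (m x) - Ψ (n x)).compLinearMap q, ?_, ?_⟩
    · filter_upwards [hΨ, hmt.eventually (hΦ i), hnt.eventually hΨ] with x h₁ h₂ h₃ c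
      exact (h₁ c).add
        (((h₂ fun k => q (c k)).comp_map (m := m) hπd fun _ => rfl).sub
          ((h₃ fun k => q (c k)).comp_map (m := n) hπd fun _ => rfl))
    · intro j hj
      rcases Finset.mem_insert.1 hj with rfl | hj
      · refine Eventually.of_forall fun x hi c hc => ?_
        have h₁ : m x = ⟨x, hi⟩ := Subtype.ext (hπ _ _ hi)
        have h₂ : n x = x := Subtype.ext (hπ _ _ hi)
        have h₃ : (fun k => q (c k)) = c := funext fun k => hqc _ (hc k)
        simp [h₁, h₂, AlternatingMap.compLinearMap_apply, h₃]
      -- Over `F j`, the retraction lands in `F i ∩ F j`, and `q` sends vectors tangent to `F j` to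
      -- vectors with anchor tangent to this intersection. There `Φ i`, `Φ j` and `Ψ` agree, so the
      -- correction is zero.
      · filter_upwards [hΨI j hj, hnt.eventually (hΨI j hj), hnt.eventually (hcompat i j)]
          with x h₁ h₂ h₃ hxj c hc
        have hGc : ∀ k, (G (q (c k)) : E) ∈ vectorSpan ℝ (F i ∩ F j) := fun k => by
          rw [hGq]
          exact linear_mem_vectorSpan (A := F j) (B := F i ∩ F j)
            (fun y hy => ⟨hπS i (hFS j hy), hπF i j hy⟩) (hc k)
        have hnj : (n x : E) ∈ F j := hπF i j hxj
        have h₄ := h₂ hnj (fun k => q (c k))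
          fun k => vectorSpan_mono ℝ Set.inter_subset_right (hGc k)
        have h₅ := h₃ (hπS i x.2) hnj (fun k => q (c k)) hGc
        simp only [AlternatingMap.add_apply, AlternatingMap.compLinearMap_apply,
          AlternatingMap.sub_apply]
        rw [h₁ hxj c hc, add_eq_left, sub_eq_zero]
        exact h₅.trans h₄.symm

end Facets

/-- Turns a statement holding near `x₀` inside a facet into one near `x₀` in the simplex,
conditional on lying in the facet. -/
theorem eventually_forall_mem_of_subset {X : Type*} [TopologicalSpace X] {S T : Set X} {x₀ : S}
    (hx₀ : (x₀ : X) ∈ T) {P : T → Prop} (h : ∀ᶠ y in 𝓝 (⟨x₀, hx₀⟩ : T), P y) :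
    ∀ᶠ x : S in 𝓝 x₀, ∀ hx : (x : X) ∈ T, P ⟨x, hx⟩ := by
  obtain ⟨U, hU, ⟨O, hO, rfl⟩, hxU⟩ := mem_nhds_iff.1 h
  filter_upwards [continuous_subtype_val.continuousAt.eventually (hO.mem_nhds hxU)] with x hx hxT
  exact hU hx

/-! ### Extension over one simplex, then over the skeleta. -/

section Extension

variable {E : Type v} [NormedAddCommGroup E] [NormedSpace ℝ E]

/-- Compatible forms on the proper faces of a simplex extend to the simplex. -/
theorem LieAlgebroidComplex.exists_extension_of_faces [FiniteDimensional ℝ E]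
    {K : Geometry.SimplicialComplex ℝ E} (A : LieAlgebroidComplex.{u} K) {p : ℕ} {s : Finset E}
    (hs : s ∈ K.faces) (η : ∀ t (ht : t ∈ K.faces), (A.obj t ht).SmoothForm p)
    (hη : ∀ t (ht : t ∈ K.faces) r (hr : r ∈ K.faces) (hrt : r ⊆ t), t ⊂ s → ∀ (x : simplex r)
      (w : Fin p → (A.obj r hr).Fiber x),
      (η t ht).toFun (Set.inclusion (simplex_mono hrt) x)
        (fun i => (A.res t ht r hr hrt).incl x (w i)) = (η r hr).toFun x w) :
    ∃ θ : (A.obj s hs).SmoothForm p, ∀ t (ht : t ∈ K.faces) (hts : t ⊂ s) (x : simplex t)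
      (w : Fin p → (A.obj t ht).Fiber x),
      θ.toFun (Set.inclusion (simplex_mono hts.1) x)
        (fun i => (A.res s hs t ht hts.1).incl x (w i)) = (η t ht).toFun x w := by
  classical
  suffices hloc : ∀ x₀ : simplex s, ∃ θ : ∀ x : simplex s, (A.obj s hs).Fiber x [⋀^Fin p]→ₗ[ℝ] ℝ,
      ∀ᶠ x in 𝓝 x₀, (A.obj s hs).SmoothFormAt θ x ∧
        ∀ t (ht : t ∈ K.faces) (hts : t ⊂ s) (hx : (x : E) ∈ simplex t)
          (w : Fin p → (A.obj t ht).Fiber ⟨x, hx⟩),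
          θ x (fun i => (A.res s hs t ht hts.1).incl ⟨x, hx⟩ (w i)) =
            (η t ht).toFun ⟨x, hx⟩ w by
    obtain ⟨θ, hθ⟩ := SmoothVectorBundle.exists_smoothForm_of_local
      (s.finite_toSet.isCompact_convexHull ℝ) (A.obj s hs).toSmoothVectorBundle (p := p)
      (fun x => {α | ∀ t (ht : t ∈ K.faces) (hts : t ⊂ s) (hx : (x : E) ∈ simplex t)
        (w : Fin p → (A.obj t ht).Fiber ⟨x, hx⟩),
        α (fun i => (A.res s hs t ht hts.1).incl ⟨x, hx⟩ (w i)) = (η t ht).toFun ⟨x, hx⟩ w})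
      (by
        intro x α hα β hβ a b _ _ hab t ht hts hx w
        have h₁ := hα t ht hts hx w
        have h₂ := hβ t ht hts hx w
        simp only [AlternatingMap.add_apply, AlternatingMap.smul_apply, smul_eq_mul]
        erw [h₁, h₂]
        rw [← add_mul, hab, one_mul]) hloc
    exact ⟨θ, fun t ht hts x w => hθ (Set.inclusion (simplex_mono hts.1) x) t ht hts x.2 w⟩
  intro x₀
  obtain ⟨e, he, hx₀, G, hG, hGe⟩ := (A.transitive s hs).exists_localTriv x₀
  let ι := {i : s // (x₀ : E) ∈ simplex (s.erase i)}
  have hK : ∀ i : s, ∀ x ∈ simplex (s.erase i), s.erase (i : E) ∈ K.faces := fun i x hx =>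
    K.down_closed hs (s.erase_subset _)
      (Finset.coe_nonempty.1 (convexHull_nonempty_iff.1 ⟨x, hx⟩))
  have hιK : ∀ i : ι, s.erase (i.1 : E) ∈ K.faces := fun i => hK i.1 _ i.2
  have hss : ∀ i : s, s.erase (i : E) ⊂ s := fun i => Finset.erase_ssubset i.2
  obtain ⟨π, hπ⟩ := exists_facet_retraction (K.indep hs) x₀.2
  choose Φ hΦ hΦη using fun i : ι =>
    (A.res s hs _ (hιK i) (hss i.1).1).exists_local_extension (η _ (hιK i)) he ⟨x₀, i.2⟩ hx₀
  have hΦη' := fun i : ι => eventually_forall_mem_of_subset i.2 (hΦη i)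
  have hbase := e.isOpen_baseSet.eventually_mem hx₀
  have hcompat : ∀ i j : ι, ∀ᶠ x : simplex s in 𝓝 x₀,
      ∀ (hi : (x : E) ∈ simplex (s.erase (i.1 : E))) (hj : (x : E) ∈ simplex (s.erase (j.1 : E)))
        (c : Fin p → Fin (A.obj s hs).rank → ℝ),
        (∀ k, (G (c k) : E) ∈
          vectorSpan ℝ (simplex (s.erase (i.1 : E)) ∩ simplex (s.erase (j.1 : E)))) →
        Φ i ⟨x, hi⟩ c = Φ j ⟨x, hj⟩ c := by
    intro i j
    filter_upwards [hbase, hΦη' i, hΦη' j] with x hxe h₁ h₂ hxi hxj c hc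
    have hr : simplex (s.erase (i.1 : E)) ∩ simplex (s.erase (j.1 : E)) =
        simplex (s.erase (i.1 : E) ∩ s.erase (j.1 : E)) := by
      rw [K.convexHull_inter_convexHull (hιK i) (hιK j), ← Finset.coe_inter]
    set r := s.erase (i.1 : E) ∩ s.erase (j.1 : E) with hrdef
    have hxr : (x : E) ∈ simplex r := hr ▸ ⟨hxi, hxj⟩
    have hri : r ⊆ s.erase (i.1 : E) := Finset.inter_subset_left
    have hrj : r ⊆ s.erase (j.1 : E) := Finset.inter_subset_right
    have hrK : r ∈ K.faces := K.down_closed (hιK i) hri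
      (Finset.coe_nonempty.1 (convexHull_nonempty_iff.1 ⟨x, hxr⟩))
    have hrs := hri.trans (hss i.1).1
    -- A vector with anchor tangent to the common face `r` comes from the algebroid on `r`, so both
    -- facet forms take on it the value of the form on `r`.
    have hex : ∀ k, ∃ a : (A.obj r hrK).Fiber ⟨x, hxr⟩,
        (A.res s hs r hrK hrs).incl ⟨x, hxr⟩ a = e.frame x (c k) := fun k => by
      refine (A.res s hs r hrK hrs).surjective ⟨x, hxr⟩ (e.frame x (c k)) ?_
      have := hc k
      rw [hr, ← e.coord_frame x hxe (c k), hGe x hxe] at this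
      exact this
    choose a ha using hex
    have key : ∀ k : ι, ∀ (hrk : r ⊆ s.erase (k.1 : E))
        (hxk : (x : E) ∈ simplex (s.erase (k.1 : E))),
        (∀ w : Fin p → (A.obj _ (hιK k)).Fiber ⟨x, hxk⟩, Φ k ⟨x, hxk⟩ (fun l => e.coord x
          ((A.res s hs _ (hιK k) (hss k.1).1).incl ⟨x, hxk⟩ (w l))) =
            (η _ (hιK k)).toFun ⟨x, hxk⟩ w) →
        Φ k ⟨x, hxk⟩ c = (η r hrK).toFun ⟨x, hxr⟩ a := by
      intro k hrk hxk h
      have h₃ := h fun l => (A.res _ (hιK k) r hrK hrk).incl ⟨x, hxr⟩ (a l)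
      have h₄ : (fun l => e.coord x ((A.res s hs _ (hιK k) (hss k.1).1).incl ⟨x, hxk⟩
          ((A.res _ (hιK k) r hrK hrk).incl ⟨x, hxr⟩ (a l)))) = c := by
        funext l
        have := A.res_trans s hs _ (hιK k) r hrK (hss k.1).1 hrk ⟨x, hxr⟩ (a l)
        exact (congrArg (e.coord x) (this.trans (ha l))).trans (e.coord_frame x hxe (c l))
      rw [h₄] at h₃
      exact h₃.trans (hη _ (hιK k) r hrK hrk (hss k.1) ⟨x, hxr⟩ a)
    exact (key i hri hxi (h₁ hxi)).trans (key j hrj hxj (h₂ hxj)).symm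
  obtain ⟨Ψ, hΨ, hΨΦ⟩ := exists_extension_of_facets
    (F := fun i : ι => simplex (s.erase (i.1 : E))) (fun i => simplex_mono (hss i.1).1) x₀
    (fun i => i.2) (fun i => π i.1) (fun i => (hπ i.1 i.1.2 i.2).1)
    (fun i => (hπ i.1 i.1.2 i.2).2.1) (fun i j => (hπ i.1 i.1.2 i.2).2.2 _ j.2) hG hΦ hcompat
    (Set.toFinite Set.univ).toFinset
  refine ⟨fun x => (Ψ x).compLinearMap (e.coord x), ?_⟩
  -- The facets missing `x₀` are closed and finite in number, so they impose no condition near `x₀`.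
  have hfar : ∀ᶠ x : simplex s in 𝓝 x₀, ∀ i : s,
      (x : E) ∈ simplex (s.erase i) → (x₀ : E) ∈ simplex (s.erase i) := by
    refine eventually_all.2 fun i => ?_
    by_cases hi : (x₀ : E) ∈ simplex (s.erase i)
    · exact Eventually.of_forall fun _ _ => hi
    · have hc : IsClosed (simplex (s.erase (i : E))) :=
        ((s.erase (i : E)).finite_toSet.isCompact_convexHull ℝ).isClosed
      filter_upwards [continuous_subtype_val.continuousAt.eventually
        (hc.isOpen_compl.mem_nhds hi)] with x hx hx'
      exact absurd hx' hx
  filter_upwards [hbase, hΨ, hfar, eventually_all.2 hΦη',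
    eventually_all.2 fun i => hΨΦ i (by simp)] with x hxe hxΨ hxf hxΦ hxΨΦ
  refine ⟨he.smoothFormAt hxe hxΨ, fun t ht hts hx w => ?_⟩
  -- Each proper face lies in a facet, and transitivity of the identifications reduces its condition
  -- to that of the facet.
  obtain ⟨i, his, hit⟩ := Finset.exists_of_ssubset hts
  have hti : t ⊆ s.erase i := Finset.subset_erase.2 ⟨hts.1, hit⟩
  have hxi : (x : E) ∈ simplex (s.erase i) := simplex_mono hti hx
  let k : ι := ⟨⟨i, his⟩, hxf ⟨i, his⟩ hxi⟩
  set w' : Fin p → (A.obj _ (hιK k)).Fiber ⟨x, hxi⟩ := fun l =>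
    (A.res _ (hιK k) t ht hti).incl ⟨x, hx⟩ (w l) with hw'
  have h₁ : ∀ l, (A.res s hs _ (hιK k) (hss k.1).1).incl ⟨x, hxi⟩ (w' l) =
      (A.res s hs t ht hts.1).incl ⟨x, hx⟩ (w l) := fun l =>
    A.res_trans s hs _ (hιK k) t ht (hss k.1).1 hti ⟨x, hx⟩ (w l)
  have h₂ := hxΦ k hxi w'
  have h₃ := hxΨΦ k hxi (fun l => e.coord x
    ((A.res s hs _ (hιK k) (hss k.1).1).incl ⟨x, hxi⟩ (w' l))) fun l => by
      rw [hGe x hxe]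
      have := (A.res s hs _ (hιK k) (hss k.1).1).anchor_incl ⟨x, hxi⟩ (w' l)
      exact this ▸ Subtype.property _
  have h₄ := hη _ (hιK k) t ht hti (hss k.1) ⟨x, hx⟩ w
  simp only [h₁] at h₃ h₂
  exact h₃.trans (h₂.trans h₄)

instance {S : Set E} (B : SmoothVectorBundle.{u} S) (p : ℕ) : Inhabited (B.SmoothForm p) :=
  ⟨⟨fun _ => 0, fun e _ _ => smoothOn_const 0 e.baseSet⟩⟩

/-- The extension of a piecewise smooth form from a subcomplex to its union with a skeleton. -/
theorem exists_extension_to_skeleton [FiniteDimensional ℝ E]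
    {K L : Geometry.SimplicialComplex ℝ E} (hL : L.faces ⊆ K.faces) (A : LieAlgebroidComplex.{u} K)
    {p : ℕ} (ξ : PiecewiseSmoothForm (A.restrict hL) p) (n : ℕ) :
    ∃ η : ∀ s (hs : s ∈ K.faces), (A.obj s hs).SmoothForm p,
      (∀ s (hs : s ∈ L.faces), η s (hL hs) = ξ.form s hs) ∧
      ∀ s (hs : s ∈ K.faces) t (ht : t ∈ K.faces) (h : t ⊆ s), s ∈ L.faces ∨ s.card ≤ n →
        ∀ (x : simplex t) (w : Fin p → (A.obj t ht).Fiber x),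
        (η s hs).toFun (Set.inclusion (simplex_mono h) x)
          (fun i => (A.res s hs t ht h).incl x (w i)) = (η t ht).toFun x w := by
  classical
  induction n with
  | zero =>
    have hext : ∀ s (hs : s ∈ K.faces), ∃ θ : (A.obj s hs).SmoothForm p,
        ∀ h : s ∈ L.faces, θ = ξ.form s h := by
      intro s hs
      by_cases h : s ∈ L.faces
      · exact ⟨ξ.form s h, fun _ => rfl⟩
      · exact ⟨default, fun h' => absurd h' h⟩
    choose η hη using hext
    refine ⟨η, fun s hs => hη s (hL hs) hs, ?_⟩
    intro s hs t ht h hsL x w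
    have hsL' : s ∈ L.faces := hsL.resolve_right fun h0 =>
      (K.nonempty_of_mem_faces hs).ne_empty (Finset.card_eq_zero.1 (Nat.le_zero.1 h0))
    have htL : t ∈ L.faces := L.down_closed hsL' h (K.nonempty_of_mem_faces ht)
    rw [hη s hs hsL', hη t ht htL]
    exact ξ.compat s hsL' t htL h x w
  | succ n ih =>
    obtain ⟨η, hηξ, hη⟩ := ih
    have hext : ∀ s (hs : s ∈ K.faces), ∃ θ : (A.obj s hs).SmoothForm p,
        (s ∈ L.faces ∨ s.card ≤ n → θ = η s hs) ∧
        (s ∈ L.faces ∨ s.card ≤ n + 1 → ∀ t (ht : t ∈ K.faces) (hts : t ⊂ s) (x : simplex t)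
          (w : Fin p → (A.obj t ht).Fiber x),
          θ.toFun (Set.inclusion (simplex_mono hts.1) x)
            (fun i => (A.res s hs t ht hts.1).incl x (w i)) = (η t ht).toFun x w) := by
      intro s hs
      by_cases hsn : s ∈ L.faces ∨ s.card ≤ n
      · exact ⟨η s hs, fun _ => rfl, fun _ t ht hts => hη s hs t ht hts.1 hsn⟩
      · by_cases hsn' : s ∈ L.faces ∨ s.card ≤ n + 1
        -- Here `s` has exactly `n + 1` vertices, so its proper faces have at most `n` and already
        -- carry compatible forms.
        · have hcard := hsn'.resolve_left fun h => hsn (Or.inl h)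
          obtain ⟨θ, hθ⟩ := A.exists_extension_of_faces hs η
            fun t ht r hr hrt hts => hη t ht r hr hrt
              (Or.inr (Nat.le_of_lt_succ ((Finset.card_lt_card hts).trans_le hcard)))
          exact ⟨θ, fun h => absurd h hsn, fun _ => hθ⟩
        · exact ⟨η s hs, fun _ => rfl, fun h => absurd h hsn'⟩
    choose θ hθη hθ using hext
    refine ⟨θ, fun s hs => (hθη s (hL hs) (Or.inl hs)).trans (hηξ s hs), ?_⟩
    intro s hs t ht h hsn x w
    rcases h.eq_or_ssubset with rfl | hts
    · simp only [A.res_self]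
    · have htn : t ∈ L.faces ∨ t.card ≤ n := hsn.imp
        (fun hsL => L.down_closed hsL h (K.nonempty_of_mem_faces ht))
        fun hc => Nat.le_of_lt_succ ((Finset.card_lt_card hts).trans_le hc)
      rw [hθη t ht htn]
      exact hθ s hs hsn t ht hts x w

end Extension

end PiecewiseSmooth

theorem proposition3p4 {E : Type v} [NormedAddCommGroup E] [NormedSpace ℝ E]
    [FiniteDimensional ℝ E] (K L : Geometry.SimplicialComplex ℝ E) (hK : K.faces.Finite)
    (hL : L.faces ⊆ K.faces) (A : PiecewiseSmooth.LieAlgebroidComplex.{u} K) (p : ℕ)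
    (ξ : PiecewiseSmooth.PiecewiseSmoothForm (A.restrict hL) p) :
    ∃ θ : PiecewiseSmooth.PiecewiseSmoothForm A p, θ.restrict hL = ξ := by
  obtain ⟨n, hn⟩ := (hK.image Finset.card).bddAbove
  obtain ⟨η, hηξ, hη⟩ := PiecewiseSmooth.exists_extension_to_skeleton hL A ξ n
  refine ⟨⟨η, fun s hs t ht h => hη s hs t ht h (Or.inr (hn ⟨s, hs, rfl⟩))⟩, ?_⟩
  apply PiecewiseSmooth.PiecewiseSmoothForm.ext
  funext s hs
  exact hηξ s hs
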